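/- **Setting.** Let $\varphi$ be a norm on $\mathbb R^2$, let $\langle\cdot,\cdot\rangle$ and $\|\cdot\|_2$ be the Euclidean inner product and norm, and write $x\times y=x_1y_2-x_2y_1$. Let $\varphi^*(p)=\max_{q\neq 0}\langle p,q\rangle/\varphi(q)$ be the dual norm, and let $\mathcal N^*$ be the set of $p$ with $\varphi^*(p)=1$ at which the subdifferential $\partial\varphi^*(p)$ has more than one element. For $p\in\mathcal N^*$ let $(w_p,v_p)$ be the unique pair of Euclidean unit vectors with $w_p\times v_p>0$ and $$\{q\in\mathbb R^2:\langle q,p\rangle=\varphi(q)\}=\{c\,v_p-d\,w_p: c,d\ge 0\},$$ and put $Q_p=\{a\,w_p+b\,v_p: a,b\ge 0\}$. Define the Hamiltonian $$\bar H_\varphi(\xi)=\max\Big\{\sup_{p\in\mathcal N^*}\frac{\langle \xi,v_p\rangle\langle\xi,w_p\rangle}{|v_p\times w_p|},\,0\Big\},\qquad \xi\in\mathbb R^2 .$$ For compact $A\subseteq\mathbb R^2$ let $\mathcal P(A)=\{x\in\mathbb R^2:\ \forall y\ne x\ \exists a\in A,\ \varphi(a-x)<\varphi(a-y)\}$. A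 bounded open set $U\subseteq\mathbb R^2$ is *Pareto efficient* (with respect to $\varphi$) if $\operatorname{int}(\mathcal P(\overline U))=U$. A convex cone $Q$ *supports* $U$ at $x_0\in\partial U$ if $x_0\in(x_0+Q)\cap\overline U$ and $(x_0+Q)\cap\overline U\subseteq\partial U$. A Pareto efficient set $U$ is *compatible* with $\varphi$ if for every $x_0\in\partial U$ there are a convex cone $Q$ supporting $U$ at $x_0$ and a $p\in\mathcal N^*$ with $Q_p\subseteq Q$. A *continuous viscosity solution* of $$\bar H_\varphi(Du)=f\ \text{ in } U,\qquad u=0\ \text{ on }\partial U \tag{$*$}$$ is a function $u\in C(\overline U)$ with $u=0$ on $\partial U$ such that for every $x_0\in U$ and every smooth $\psi$ defined in a neighbourhood of $x_0$ with $\psi(x_0)=u(x_0)$: if $\psi\ge u$ near $x_0$ then $\bar H_\varphi(D\psi(x_0))\le f(x_0)$, and if $\psi\le u$ near $x_0$ then $\bar H_\varphi(D\psi(x_0))\ge f(x_0)$. **Proposition.** Let $U=(-1,1)^2$, $\varphi(x)=\max(\sqrt2\,|x_1|,\|x\|_2)$ and $f\equiv 1$ in $U$. Then $U$ is Pareto efficient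 but not compatible with $\varphi$, and the boundary value problem $(*)$ has no continuous viscosity solution. -/

import Mathlib

open scoped ContDiff

noncomputable section

namespace ParetoPeeling

/-- The plane `ℝ²` with its Euclidean norm and inner product. -/
abbrev Plane := EuclideanSpace ℝ (Fin 2)

/-- The cross product `x × y = x₁ y₂ - x₂ y₁`. -/
def cross (x y : Plane) : ℝ := x 0 * y 1 - x 1 * y 0

/-- The dual norm `φ*(p) = max {⟨p, q⟩ / φ(q) | q ≠ 0}` of a norm `φ` on the plane. -/
def dualNorm (φ : Plane → ℝ) (p : Plane) : ℝ :=
  sSup {r : ℝ | ∃ q : Plane, q ≠ 0 ∧ r = inner ℝ p q / φ q}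

/-- The subdifferential of a function `g` on the plane at `p`. -/
def subdifferential (g : Plane → ℝ) (p : Plane) : Set Plane :=
  {q | ∀ p' : Plane, g p + inner ℝ q (p' - p) ≤ g p'}

/-- The set `𝒩*` of corner points of `{φ* = 1}`: the points of `{φ* = 1}` at which the
subdifferential of `φ*` has more than one element. -/
def corners (φ : Plane → ℝ) : Set Plane :=
  {p | dualNorm φ p = 1 ∧ (subdifferential (dualNorm φ) p).Nontrivial}

/-- The cone `𝒬_p = {q | ⟨q, p⟩ = φ(q)}` over the facet with normal `p`. -/
def facetCone (φ : Plane → ℝ) (p : Plane) : Set Plane :=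
  {q | inner ℝ q p = φ q}

/-- `(w, v)` is the basis `(w_p, v_p)` attached to `p`: both vectors have Euclidean length one,
`w × v > 0`, and `𝒬_p = {c v - d w | c, d ≥ 0}`. For a corner `p` of a norm, there is exactly
one such pair. -/
def IsFacetBasis (φ : Plane → ℝ) (p w v : Plane) : Prop :=
  ‖w‖ = 1 ∧ ‖v‖ = 1 ∧ 0 < cross w v ∧
    facetCone φ p = {x | ∃ c d : ℝ, 0 ≤ c ∧ 0 ≤ d ∧ x = c • v - d • w}

/-- The flat cone `Q_p = {a w_p + b v_p | a, b ≥ 0}`. -/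
def flatCone (φ : Plane → ℝ) (p : Plane) : Set Plane :=
  {x | ∃ w v : Plane, IsFacetBasis φ p w v ∧
    ∃ a b : ℝ, 0 ≤ a ∧ 0 ≤ b ∧ x = a • w + b • v}

/-- The effective Hamiltonian
`H̄_φ(ξ) = max {sup_{p ∈ 𝒩*} ⟨ξ, v_p⟩ ⟨ξ, w_p⟩ / |v_p × w_p|, 0}`. -/
def hamiltonian (φ : Plane → ℝ) (ξ : Plane) : ℝ :=
  max (sSup {r : ℝ | ∃ p ∈ corners φ, ∃ w v : Plane, IsFacetBasis φ p w v ∧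
    r = inner ℝ ξ v * inner ℝ ξ w / |cross v w|}) 0

/-- The Pareto hull `𝒫(A)` of a set `A` with respect to `φ`. -/
def paretoHull (φ : Plane → ℝ) (A : Set Plane) : Set Plane :=
  {x | ∀ y : Plane, y ≠ x → ∃ a ∈ A, φ (a - x) < φ (a - y)}

/-- A (bounded, open) set `U` is Pareto efficient if `int (𝒫(closure U)) = U`. -/
def IsParetoEfficient (φ : Plane → ℝ) (U : Set Plane) : Prop :=
  interior (paretoHull φ (closure U)) = U

/-- The convex cone `Q` supports `U` at `x₀`, i.e. `Q` belongs to `𝒞(U, x₀)`. -/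
def Supports (Q : ConvexCone ℝ Plane) (U : Set Plane) (x₀ : Plane) : Prop :=
  x₀ ∈ ((fun q => x₀ + q) '' (Q : Set Plane)) ∩ closure U ∧
    ((fun q => x₀ + q) '' (Q : Set Plane)) ∩ closure U ⊆ frontier U

/-- The Pareto efficient set `U` is compatible with `φ`: at each boundary point some supporting
convex cone contains one of the flat cones `Q_p`, `p ∈ 𝒩*`. -/
def IsCompatible (φ : Plane → ℝ) (U : Set Plane) : Prop :=
  ∀ x₀ ∈ frontier U, ∃ Q : ConvexCone ℝ Plane, Supports Q U x₀ ∧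
    ∃ p ∈ corners φ, flatCone φ p ⊆ (Q : Set Plane)

/-- `w` is a viscosity subsolution of `H(Du) = f` in the open set `U`: it is upper semicontinuous
in `U` and `H(Dψ(x₀)) ≤ f(x₀)` whenever a function `ψ`, smooth in a neighbourhood of `x₀ ∈ U`,
touches `w` from above at `x₀`. -/
def IsViscositySubsolution (H : Plane → ℝ) (f : Plane → ℝ) (U : Set Plane) (w : Plane → ℝ) :
    Prop :=
  UpperSemicontinuousOn w U ∧
    ∀ x₀ ∈ U, ∀ (N : Set Plane) (ψ : Plane → ℝ), IsOpen N → x₀ ∈ N → ContDiffOn ℝ ∞ ψ N →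
      (∃ r : ℝ, 0 < r ∧ Metric.closedBall x₀ r ⊆ U ∩ N ∧
        ∀ x ∈ Metric.closedBall x₀ r, w x ≤ ψ x) →
      ψ x₀ = w x₀ → H (gradient ψ x₀) ≤ f x₀

/-- `v` is a viscosity supersolution of `H(Du) = f` in the open set `U`: it is lower semicontinuous
in `U` and `H(Dψ(x₀)) ≥ f(x₀)` whenever a function `ψ`, smooth in a neighbourhood of `x₀ ∈ U`,
touches `v` from below at `x₀`. -/
def IsViscositySupersolution (H : Plane → ℝ) (f : Plane → ℝ) (U : Set Plane) (v : Plane → ℝ) :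
    Prop :=
  LowerSemicontinuousOn v U ∧
    ∀ x₀ ∈ U, ∀ (N : Set Plane) (ψ : Plane → ℝ), IsOpen N → x₀ ∈ N → ContDiffOn ℝ ∞ ψ N →
      (∃ r : ℝ, 0 < r ∧ Metric.closedBall x₀ r ⊆ U ∩ N ∧
        ∀ x ∈ Metric.closedBall x₀ r, ψ x ≤ v x) →
      ψ x₀ = v x₀ → f x₀ ≤ H (gradient ψ x₀)

/-- `u`, of which only the restriction to `closure U` matters, is a continuous viscosity solution
of the boundary value problem `H(Du) = f` in `U`, `u = 0` on `∂U`. -/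
def IsViscositySolutionDirichlet (H : Plane → ℝ) (f : Plane → ℝ) (U : Set Plane)
    (u : Plane → ℝ) : Prop :=
  ContinuousOn u (closure U) ∧ IsViscositySubsolution H f U u ∧
    IsViscositySupersolution H f U u ∧ ∀ x ∈ frontier U, u x = 0

end ParetoPeeling

end

/-!
The unit ball of `φ(x) = max (√2 |x₁|) ‖x‖₂` is the Euclidean disc truncated by the two vertical
facets `x₁ = ±1/√2`. If `φ` is additive on two linearly independent vectors, then strict
convexity of the Euclidean norm forces both of them to lie in the same cone `|x₂| ≤ ± x₁` over one
of these facets. Hence the only corners of the dual ball are `(±√2, 0)`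
(`eq_of_mem_corners`), their flat cones are `{|x₁| ≤ ∓ x₂}`, and
`H̄_φ(ξ) ≤ max ((ξ₂² - ξ₁²) / 2) 0` (`hamiltonian_truncNorm_le`).

* Since `φ` is monotone in the absolute values of the coordinates, clamping a point outside the
  closed square to the square does not increase its distance to any point of the square. So the
  closed square is its own Pareto hull.
* Both flat cones, translated to the boundary point `(1, 0)`, meet the open square, so the square
  is not compatible with `φ`.
* A continuous solution `u` would be uniformly small near the side `x₁ = 1`. Penalising the
  `x₁`-direction by a large multiple of `(x₁ - a)²`, one can touch `u` from below near that side
  by a concave paraboloid whose `x₂`-slope is at most `1/2`. A large `x₁`-slope only decreases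
  `ξ₂² - ξ₁²`, so the Hamiltonian of the gradient is at most `1/8 < 1`, which contradicts the
  supersolution property.
-/

namespace ParetoPeeling

/-! ### The truncated Euclidean norm -/

/-- The norm `max (√2 |x₁|) ‖x‖₂`, whose unit ball is the Euclidean disc truncated at
`|x₁| ≤ 1/√2`. -/
noncomputable def truncNorm (x : Plane) : ℝ := max (Real.sqrt 2 * |x 0|) ‖x‖

lemma inner_plane (x y : Plane) : inner ℝ x y = x 0 * y 0 + x 1 * y 1 := by
  simp [PiLp.inner_apply, Fin.sum_univ_two, mul_comm]

lemma norm_plane (x : Plane) : ‖x‖ = Real.sqrt (x 0 ^ 2 + x 1 ^ 2) := by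
  simp [EuclideanSpace.norm_eq, Fin.sum_univ_two]

lemma norm_le_truncNorm (x : Plane) : ‖x‖ ≤ truncNorm x := le_max_right _ _

lemma sqrt_two_mul_abs_le_truncNorm (x : Plane) : Real.sqrt 2 * |x 0| ≤ truncNorm x :=
  le_max_left _ _

lemma truncNorm_pos {x : Plane} (hx : x ≠ 0) : 0 < truncNorm x :=
  (norm_pos_iff.2 hx).trans_le (norm_le_truncNorm x)

lemma truncNorm_zero : truncNorm 0 = 0 := by simp [truncNorm]

lemma truncNorm_smul {c : ℝ} (hc : 0 ≤ c) (x : Plane) :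
    truncNorm (c • x) = c * truncNorm x := by
  simp only [truncNorm, PiLp.smul_apply, smul_eq_mul, abs_mul, abs_of_nonneg hc, norm_smul,
    Real.norm_eq_abs, mul_max_of_nonneg _ _ hc, mul_left_comm]

lemma truncNorm_add_le (x y : Plane) : truncNorm (x + y) ≤ truncNorm x + truncNorm y := by
  refine max_le ?_ ?_
  · have h : Real.sqrt 2 * |(x + y) 0| ≤ Real.sqrt 2 * (|x 0| + |y 0|) :=
      mul_le_mul_of_nonneg_left (abs_add_le _ _) (Real.sqrt_nonneg _)
    linarith [sqrt_two_mul_abs_le_truncNorm x, sqrt_two_mul_abs_le_truncNorm y]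
  · linarith [norm_add_le x y, norm_le_truncNorm x, norm_le_truncNorm y]

lemma truncNorm_mono {x y : Plane} (h : ∀ i, |x i| ≤ |y i|) : truncNorm x ≤ truncNorm y := by
  refine max_le_max (mul_le_mul_of_nonneg_left (h 0) (Real.sqrt_nonneg _)) ?_
  rw [norm_plane, norm_plane]
  exact Real.sqrt_le_sqrt (add_le_add (sq_le_sq.2 (h 0)) (sq_le_sq.2 (h 1)))

/-- If `⟨·, p⟩` agrees with the norm on `a`, `b` and `a + b` for two vectors in different
directions, then `p` is the normal `(±√2, 0)` of a facet. The Euclidean part of the norm is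
strictly subadditive on `a + b`, so the norm of all three vectors is `√2` times the absolute value
of the first coordinate. -/
lemma eq_of_inner_eq_truncNorm {a b p : Plane} (hab : ¬ SameRay ℝ a b)
    (ha : inner ℝ a p = truncNorm a) (hb : inner ℝ b p = truncNorm b)
    (hs : inner ℝ (a + b) p = truncNorm (a + b)) :
    p = !₂[Real.sqrt 2, 0] ∨ p = !₂[-Real.sqrt 2, 0] := by
  have hlt := not_sameRay_iff_norm_add_lt.1 hab
  have h2 : (0 : ℝ) < Real.sqrt 2 := by positivity
  have hadd : truncNorm (a + b) = truncNorm a + truncNorm b := by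
    rw [← ha, ← hb, ← hs, inner_add_left]
  have hna := norm_le_truncNorm a
  have hnb := norm_le_truncNorm b
  have hsa := sqrt_two_mul_abs_le_truncNorm a
  have hsb := sqrt_two_mul_abs_le_truncNorm b
  have hsum : truncNorm (a + b) = Real.sqrt 2 * |a 0 + b 0| := by
    rcases max_choice (Real.sqrt 2 * |(a + b) 0|) ‖a + b‖ with h | h
    · exact h
    · have h : truncNorm (a + b) = ‖a + b‖ := h
      linarith
  have hle : Real.sqrt 2 * |a 0 + b 0| ≤ Real.sqrt 2 * (|a 0| + |b 0|) :=
    mul_le_mul_of_nonneg_left (abs_add_le _ _) h2.le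
  have hea : truncNorm a = Real.sqrt 2 * |a 0| := by linarith
  have heb : truncNorm b = Real.sqrt 2 * |b 0| := by linarith
  have habs : |a 0 + b 0| = |a 0| + |b 0| := by
    apply mul_left_cancel₀ h2.ne'
    linarith
  have ha0 : a ≠ 0 := fun h => hab (h ▸ SameRay.zero_left b)
  have hb0 : b ≠ 0 := fun h => hab (h ▸ SameRay.zero_right a)
  have ha1 : a 0 ≠ 0 := by
    intro h
    have := truncNorm_pos ha0
    simp [hea, h] at this
  have hb1 : b 0 ≠ 0 := by
    intro h
    have := truncNorm_pos hb0
    simp [heb, h] at this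
  have hdet_of : ∀ s : ℝ, 0 < s * a 0 → 0 < s * b 0 → cross a b ≠ 0 := by
    intro s hs1 hs2 h
    refine hab (Or.inr (Or.inr ⟨s * b 0, s * a 0, hs2, hs1, ?_⟩))
    unfold cross at h
    ext i
    fin_cases i
    · simp; ring
    · simp; linear_combination -s * h
  have hfin : ∀ s : ℝ, 0 < s * a 0 → 0 < s * b 0 → |a 0| = s * a 0 → |b 0| = s * b 0 →
      p = !₂[s * Real.sqrt 2, 0] := by
    intro s hs1 hs2 e1 e2
    have hd := hdet_of s hs1 hs2
    rw [inner_plane, hea, e1] at ha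
    rw [inner_plane, heb, e2] at hb
    have h0 : p 0 = s * Real.sqrt 2 := by
      apply mul_left_cancel₀ hd
      unfold cross
      linear_combination b 1 * ha - a 1 * hb
    have h1 : p 1 = 0 := by
      apply mul_left_cancel₀ hd
      unfold cross
      linear_combination a 0 * hb - b 0 * ha
    ext i
    fin_cases i
    · simpa using h0
    · simpa using h1
  rcases (abs_add_eq_add_abs_iff _ _).1 habs with ⟨h, h'⟩ | ⟨h, h'⟩
  · left
    have h := lt_of_le_of_ne h ha1.symm
    have h' := lt_of_le_of_ne h' hb1.symm
    simpa using hfin 1 (by linarith) (by linarith) (by rw [abs_of_pos h, one_mul])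
      (by rw [abs_of_pos h', one_mul])
  · right
    have h := lt_of_le_of_ne h ha1
    have h' := lt_of_le_of_ne h' hb1
    simpa using hfin (-1) (by linarith) (by linarith) (by rw [abs_of_neg h]; ring)
      (by rw [abs_of_neg h']; ring)

/-! ### Corners of the dual norm, facet bases and the Hamiltonian -/

lemma dualNorm_truncNorm_le {p : Plane} {c : ℝ} (hc : 0 ≤ c)
    (h : ∀ q, inner ℝ p q ≤ c * truncNorm q) : dualNorm truncNorm p ≤ c := by
  refine Real.sSup_le ?_ hc
  rintro r ⟨q, hq, rfl⟩
  exact (div_le_iff₀ (truncNorm_pos hq)).2 (h q)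

lemma inner_le_dualNorm_truncNorm_mul (p q : Plane) :
    inner ℝ p q ≤ dualNorm truncNorm p * truncNorm q := by
  rcases eq_or_ne q 0 with rfl | hq
  · simp [truncNorm_zero]
  · rw [← div_le_iff₀ (truncNorm_pos hq)]
    refine le_csSup ⟨‖p‖, ?_⟩ ⟨q, hq, rfl⟩
    rintro r ⟨x, hx, rfl⟩
    rw [div_le_iff₀ (truncNorm_pos hx)]
    exact (real_inner_le_norm p x).trans
      (mul_le_mul_of_nonneg_left (norm_le_truncNorm x) (norm_nonneg p))

lemma inner_eq_one_of_mem_subdifferential {p q : Plane} (hp : dualNorm truncNorm p = 1)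
    (hq : q ∈ subdifferential (dualNorm truncNorm) p) :
    inner ℝ q p = 1 ∧ truncNorm q = 1 := by
  have hp0 : dualNorm truncNorm 0 ≤ 0 := dualNorm_truncNorm_le le_rfl (by simp)
  have hp2 : dualNorm truncNorm ((2 : ℝ) • p) ≤ 2 := by
    refine dualNorm_truncNorm_le (by norm_num) fun x => ?_
    have := inner_le_dualNorm_truncNorm_mul p x
    rw [real_inner_smul_left]
    rw [hp] at this
    linarith
  have h0 := hq 0
  have h2 := hq ((2 : ℝ) • p)
  rw [zero_sub, inner_neg_right] at h0
  rw [inner_sub_right, real_inner_smul_right] at h2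
  have hqp : inner ℝ q p = 1 := by linarith
  -- Testing the subgradient inequality at points of the dual unit ball bounds `truncNorm q`.
  have htest : ∀ p', (∀ x, inner ℝ p' x ≤ truncNorm x) → inner ℝ q p' ≤ 1 := by
    intro p' hp'
    have h1 : dualNorm truncNorm p' ≤ 1 :=
      dualNorm_truncNorm_le zero_le_one (by simpa using hp')
    have h3 := hq p'
    rw [inner_sub_right] at h3
    linarith
  have hfacet : ∀ s : ℝ, |s| = 1 → Real.sqrt 2 * (s * q 0) ≤ 1 := by
    intro s hs
    have := htest !₂[s * Real.sqrt 2, 0] fun x => by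
      refine le_trans ?_ (sqrt_two_mul_abs_le_truncNorm x)
      have h4 : s * x 0 ≤ |x 0| := by
        have := le_abs_self (s * x 0)
        rwa [abs_mul, hs, one_mul] at this
      have h5 := mul_le_mul_of_nonneg_left h4 (Real.sqrt_nonneg 2)
      rw [inner_plane]
      simp
      linarith
    rw [inner_plane] at this
    simp at this
    linarith
  refine ⟨hqp, le_antisymm (max_le ?_ ?_) ?_⟩
  · rcases abs_choice (q 0) with h | h
    · simpa [h] using hfacet 1 (by simp)
    · simpa [h] using hfacet (-1) (by simp)
  · have hq0 : ‖q‖ ≠ 0 := by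
      intro h
      rw [norm_eq_zero.1 h, inner_zero_left] at hqp
      norm_num at hqp
    have := htest (‖q‖⁻¹ • q) fun x => by
      rw [real_inner_smul_left]
      calc ‖q‖⁻¹ * inner ℝ q x ≤ ‖q‖⁻¹ * (‖q‖ * ‖x‖) :=
            mul_le_mul_of_nonneg_left (real_inner_le_norm q x) (by positivity)
        _ = ‖x‖ := by field_simp
        _ ≤ truncNorm x := norm_le_truncNorm x
    rw [real_inner_smul_right, real_inner_self_eq_norm_sq] at this
    calc ‖q‖ = ‖q‖⁻¹ * ‖q‖ ^ 2 := by field_simp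
      _ ≤ 1 := this
  · have := inner_le_dualNorm_truncNorm_mul p q
    rwa [real_inner_comm, hqp, hp, one_mul] at this

lemma eq_of_mem_corners {p : Plane} (hp : p ∈ corners truncNorm) :
    p = !₂[Real.sqrt 2, 0] ∨ p = !₂[-Real.sqrt 2, 0] := by
  obtain ⟨hp1, a, ha, b, hb, hab⟩ := hp
  obtain ⟨ha1, ha2⟩ := inner_eq_one_of_mem_subdifferential hp1 ha
  obtain ⟨hb1, hb2⟩ := inner_eq_one_of_mem_subdifferential hp1 hb
  refine eq_of_inner_eq_truncNorm (a := a) (b := b) ?_ (ha1.trans ha2.symm)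
    (hb1.trans hb2.symm) ?_
  · intro h
    have ha0 : a ≠ 0 := by rintro rfl; simp at ha1
    have hb0 : b ≠ 0 := by rintro rfl; simp at hb1
    obtain ⟨c, hc, rfl⟩ := h.exists_pos_left ha0 hb0
    rw [truncNorm_smul hc.le, ha2, mul_one] at hb2
    exact hab (by rw [hb2, one_smul])
  · have := inner_le_dualNorm_truncNorm_mul p (a + b)
    rw [hp1, one_mul, real_inner_comm] at this
    refine le_antisymm this ?_
    rw [inner_add_left, ha1, hb1]
    linarith [truncNorm_add_le a b]

lemma mem_facetCone_iff {s : ℝ} (hs : |s| = 1) (q : Plane) :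
    q ∈ facetCone truncNorm !₂[s * Real.sqrt 2, 0] ↔ |q 1| ≤ s * q 0 := by
  have h2 : (0 : ℝ) < Real.sqrt 2 := by positivity
  have hss : s ^ 2 = 1 := by rw [← sq_abs, hs, one_pow]
  have hin : inner ℝ q !₂[s * Real.sqrt 2, 0] = Real.sqrt 2 * (s * q 0) := by
    rw [inner_plane]
    simp
    ring
  have hle : s * q 0 ≤ |q 0| := by
    have := le_abs_self (s * q 0)
    rwa [abs_mul, hs, one_mul] at this
  have hnorm : ‖q‖ ^ 2 = q 0 ^ 2 + q 1 ^ 2 := by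
    rw [norm_plane, Real.sq_sqrt (by positivity)]
  change inner ℝ q _ = truncNorm q ↔ _
  rw [hin]
  constructor
  · intro h
    have h1 := sqrt_two_mul_abs_le_truncNorm q
    have h3 : s * q 0 = |q 0| :=
      le_antisymm hle (le_of_mul_le_mul_left (h ▸ h1) h2)
    have h4 := norm_le_truncNorm q
    rw [← h, h3] at h4
    rw [h3, ← sq_le_sq]
    have h5 := pow_le_pow_left₀ (norm_nonneg q) h4 2
    rw [mul_pow, Real.sq_sqrt (by norm_num), sq_abs, hnorm] at h5
    linarith
  · intro h
    have h3 : s * q 0 = |q 0| := by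
      have h4 : 0 ≤ s * q 0 := (abs_nonneg _).trans h
      rw [← abs_of_nonneg h4, abs_mul, hs, one_mul]
    rw [h3] at h ⊢
    refine le_antisymm (sqrt_two_mul_abs_le_truncNorm q) (max_le le_rfl ?_)
    refine abs_le_of_sq_le_sq' ?_ (by positivity) |>.2
    rw [mul_pow, Real.sq_sqrt (by norm_num), sq_abs, hnorm]
    linarith [sq_le_sq.2 h]

/-- The basis `(w_p, v_p)` of the corner `p = (s √2, 0)`, `s = ±1`. -/
lemma isFacetBasis_iff {s : ℝ} (hs : |s| = 1) (w v : Plane) :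
    IsFacetBasis truncNorm !₂[s * Real.sqrt 2, 0] w v ↔
      w = !₂[-s / Real.sqrt 2, -s / Real.sqrt 2] ∧ v = !₂[s / Real.sqrt 2, -s / Real.sqrt 2] := by
  have h2 : (0 : ℝ) < Real.sqrt 2 := by positivity
  have hsq : Real.sqrt 2 ^ 2 = 2 := Real.sq_sqrt (by norm_num)
  have hss : s ^ 2 = 1 := by rw [← sq_abs, hs, one_pow]
  constructor
  · rintro ⟨hw, hv, hc, hcone⟩
    have hmem : ∀ c d : ℝ, 0 ≤ c → 0 ≤ d → |c * v 1 - d * w 1| ≤ s * (c * v 0 - d * w 0) := by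
      intro c d hc hd
      have h : c • v - d • w ∈ facetCone truncNorm !₂[s * Real.sqrt 2, 0] :=
        hcone ▸ ⟨c, d, hc, hd, rfl⟩
      simpa using (mem_facetCone_iff hs _).1 h
    have hv1 : |v 1| ≤ s * v 0 := by simpa using hmem 1 0 zero_le_one le_rfl
    have hw1 : |w 1| ≤ -(s * w 0) := by simpa using hmem 0 1 le_rfl zero_le_one
    have hgen : ∀ t : ℝ, |t| ≤ 1 →
        ∃ c d : ℝ, 0 ≤ c ∧ 0 ≤ d ∧ s = c * v 0 - d * w 0 ∧ t = c * v 1 - d * w 1 := by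
      intro t ht
      have h : !₂[s, t] ∈ facetCone truncNorm !₂[s * Real.sqrt 2, 0] := by
        rw [mem_facetCone_iff hs]
        simpa [← sq, hss] using ht
      rw [hcone] at h
      obtain ⟨c, d, hc, hd, h⟩ := h
      exact ⟨c, d, hc, hd, by simpa using congrArg (· 0) h, by simpa using congrArg (· 1) h⟩
    unfold cross at hc
    -- The two extreme rays of the cone are found by comparing orientations with `v` and `w`.
    have hv2 : v 1 = -v 0 := by
      obtain ⟨c, d, -, hd, h0, h1⟩ := hgen (-s) (by rw [abs_neg, hs])
      have h3 : 0 ≤ v 0 * -s - v 1 * s := by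
        have e : v 0 * -s - v 1 * s = d * (w 0 * v 1 - w 1 * v 0) := by
          linear_combination v 0 * h1 - v 1 * h0
        exact e ▸ mul_nonneg hd hc.le
      have h4 : 0 ≤ s * v 0 + s * v 1 := by
        have := neg_abs_le (s * v 1)
        rw [abs_mul, hs, one_mul] at this
        linarith
      have h5 : s * (v 1 + v 0) = 0 := by linarith
      linear_combination s * h5 - (v 1 + v 0) * hss
    have hw2 : w 1 = w 0 := by
      obtain ⟨c, d, hc', -, h0, h1⟩ := hgen s hs.le
      have h3 : 0 ≤ w 0 * s - w 1 * s := by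
        have e : w 0 * s - w 1 * s = c * (w 0 * v 1 - w 1 * v 0) := by
          linear_combination w 0 * h1 - w 1 * h0
        exact e ▸ mul_nonneg hc' hc.le
      have h4 : 0 ≤ -(s * w 0) + s * w 1 := by
        have := neg_abs_le (s * w 1)
        rw [abs_mul, hs, one_mul] at this
        linarith
      have h5 : s * (w 1 - w 0) = 0 := by linarith
      linear_combination s * h5 - (w 1 - w 0) * hss
    have hvn : (Real.sqrt 2 * (s * v 0)) ^ 2 = 1 ^ 2 := by
      rw [norm_plane, Real.sqrt_eq_one, hv2] at hv
      rw [mul_pow, mul_pow, hsq, hss]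
      linarith
    have hwn : (Real.sqrt 2 * -(s * w 0)) ^ 2 = 1 ^ 2 := by
      rw [norm_plane, Real.sqrt_eq_one, hw2] at hw
      rw [mul_pow, neg_sq, mul_pow, hsq, hss]
      linarith
    have hv3 := (pow_left_inj₀ (mul_nonneg h2.le ((abs_nonneg _).trans hv1)) zero_le_one
      two_ne_zero).1 hvn
    have hw3 := (pow_left_inj₀ (mul_nonneg h2.le ((abs_nonneg _).trans hw1)) zero_le_one
      two_ne_zero).1 hwn
    have hv4 : v 0 = s / Real.sqrt 2 := by
      rw [eq_div_iff h2.ne']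
      linear_combination s * hv3 - Real.sqrt 2 * v 0 * hss
    have hw4 : w 0 = -s / Real.sqrt 2 := by
      rw [eq_div_iff h2.ne']
      linear_combination -s * hw3 - Real.sqrt 2 * w 0 * hss
    constructor
    · ext i
      fin_cases i
      · simpa using hw4
      · simpa using hw2.trans hw4
    · ext i
      fin_cases i
      · simpa using hv4
      · simp [hv2, hv4, neg_div]
  · rintro ⟨rfl, rfl⟩
    refine ⟨?_, ?_, ?_, ?_⟩
    · rw [norm_plane, Real.sqrt_eq_one]
      simp [div_pow, hsq, hss]
      norm_num
    · rw [norm_plane, Real.sqrt_eq_one]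
      simp [div_pow, hsq, hss]
      norm_num
    · simp only [cross]
      simp
      field_simp
      simp [hss]
    · ext q
      rw [mem_facetCone_iff hs]
      constructor
      · intro h
        have h3 : |s * q 1| ≤ s * q 0 := by rwa [abs_mul, hs, one_mul]
        obtain ⟨h4, h5⟩ := abs_le.1 h3
        refine ⟨Real.sqrt 2 / 2 * (s * q 0 - s * q 1), Real.sqrt 2 / 2 * (s * q 0 + s * q 1),
          mul_nonneg (by positivity) (by linarith), mul_nonneg (by positivity) (by linarith), ?_⟩
        ext i
        fin_cases i
        · simp
          field_simp
          linear_combination (-2) * q 0 * hss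
        · simp
          field_simp
          linear_combination (-2) * q 1 * hss
      · rintro ⟨c, d, hc, hd, rfl⟩
        have e : s * (c * (s / Real.sqrt 2) - d * (-s / Real.sqrt 2)) = (c + d) / Real.sqrt 2 := by
          field_simp
          linear_combination (c + d) * hss
        have e' : |c * (-s / Real.sqrt 2) - d * (-s / Real.sqrt 2)| = |d - c| / Real.sqrt 2 := by
          rw [show c * (-s / Real.sqrt 2) - d * (-s / Real.sqrt 2) = s * (d - c) / Real.sqrt 2 by
            ring, abs_div, abs_mul, hs, one_mul, abs_of_pos h2]
        simp
        rw [e, e']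
        gcongr
        exact abs_le.2 ⟨by linarith, by linarith⟩

lemma hamiltonian_truncNorm_le (ξ : Plane) :
    hamiltonian truncNorm ξ ≤ max ((ξ 1 ^ 2 - ξ 0 ^ 2) / 2) 0 := by
  have hsq : Real.sqrt 2 ^ 2 = 2 := Real.sq_sqrt (by norm_num)
  refine max_le (Real.sSup_le ?_ (le_max_right _ _)) (le_max_right _ _)
  rintro r ⟨p, hp, w, v, hwv, rfl⟩
  refine le_trans (le_of_eq ?_) (le_max_left _ _)
  obtain ⟨s, hs, rfl⟩ : ∃ s : ℝ, |s| = 1 ∧ p = !₂[s * Real.sqrt 2, 0] := by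
    rcases eq_of_mem_corners hp with h | h
    · exact ⟨1, by simp, by simpa using h⟩
    · exact ⟨-1, by simp, by simpa using h⟩
  have hss : s ^ 2 = 1 := by rw [← sq_abs, hs, one_pow]
  obtain ⟨rfl, rfl⟩ := (isFacetBasis_iff hs w v).1 hwv
  have hc : cross !₂[s / Real.sqrt 2, -s / Real.sqrt 2] !₂[-s / Real.sqrt 2, -s / Real.sqrt 2]
      = -1 := by
    simp only [cross]
    simp
    field_simp
    linear_combination (-2) * hss + hsq
  rw [hc, inner_plane, inner_plane]
  simp
  field_simp
  linear_combination (ξ 1 ^ 2 - ξ 0 ^ 2) * (2 * hss - hsq)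

/-! ### The open square -/

/-- The open square `(-1, 1)²`. -/
def openSquare : Set Plane := {x | ∀ i, x i ∈ Set.Ioo (-1 : ℝ) 1}

lemma openSquare_eq_preimage : openSquare =
    EuclideanSpace.equiv (Fin 2) ℝ ⁻¹' Set.univ.pi fun _ => Set.Ioo (-1 : ℝ) 1 := by
  ext x
  simp [openSquare]

lemma closure_openSquare : closure openSquare = {x | ∀ i, x i ∈ Set.Icc (-1 : ℝ) 1} := by
  rw [openSquare_eq_preimage, ← ContinuousLinearEquiv.coe_toHomeomorph,
    ← Homeomorph.preimage_closure, closure_pi_set]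
  ext x
  simp [-Set.pi_univ_Icc, closure_Ioo (show (-1 : ℝ) ≠ 1 by norm_num)]

lemma isOpen_openSquare : IsOpen openSquare := by
  rw [openSquare_eq_preimage]
  exact (isOpen_set_pi Set.finite_univ fun _ _ => isOpen_Ioo).preimage
    (EuclideanSpace.equiv (Fin 2) ℝ).continuous

lemma interior_closure_openSquare : interior (closure openSquare) = openSquare := by
  rw [openSquare_eq_preimage, ← ContinuousLinearEquiv.coe_toHomeomorph,
    ← Homeomorph.preimage_closure, ← Homeomorph.preimage_interior, closure_pi_set,
    interior_pi_set Set.finite_univ]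
  simp [closure_Ioo (show (-1 : ℝ) ≠ 1 by norm_num)]

lemma isCompact_closure_openSquare : IsCompact (closure openSquare) := by
  have h : closure openSquare = (EuclideanSpace.equiv (Fin 2) ℝ).toHomeomorph ⁻¹'
      Set.univ.pi fun _ => Set.Icc (-1 : ℝ) 1 := by
    rw [closure_openSquare]
    ext x
    simp [-Set.pi_univ_Icc]
  rw [h, Homeomorph.isCompact_preimage]
  exact isCompact_univ_pi fun _ => isCompact_Icc

lemma isParetoEfficient_openSquare : IsParetoEfficient truncNorm openSquare := by
  have h : paretoHull truncNorm (closure openSquare) = closure openSquare := by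
    apply Set.Subset.antisymm
    · intro x hx
      -- Clamping `x` to the square decreases all coordinate distances to points of the square.
      by_contra hxU
      set y : Plane := !₂[max (-1) (min 1 (x 0)), max (-1) (min 1 (x 1))] with hy
      have hyi : ∀ i, y i = max (-1) (min 1 (x i)) := by
        intro i
        fin_cases i <;> simp [hy]
      have hyU : y ∈ closure openSquare := by
        rw [closure_openSquare]
        intro i
        rw [hyi]
        exact ⟨le_max_left _ _, max_le (by norm_num) (min_le_left _ _)⟩
      obtain ⟨a, ha, hlt⟩ := hx y (fun h => hxU (h ▸ hyU))
      rw [closure_openSquare] at ha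
      refine hlt.not_ge (truncNorm_mono fun i => ?_)
      obtain ⟨h1, h2⟩ := ha i
      rw [PiLp.sub_apply, PiLp.sub_apply, hyi]
      rcases le_total (x i) (-1) with h3 | h3
      · rw [min_eq_right (by linarith), max_eq_left h3, abs_of_nonneg (by linarith),
          abs_of_nonneg (by linarith)]
        linarith
      · rcases le_total 1 (x i) with h4 | h4
        · rw [min_eq_left h4, max_eq_right (by norm_num), abs_of_nonpos (by linarith),
            abs_of_nonpos (by linarith)]
          linarith
        · rw [min_eq_right h4, max_eq_right h3]
    · intro x hx y hy
      refine ⟨x, hx, ?_⟩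
      rw [sub_self, truncNorm_zero]
      exact truncNorm_pos (sub_ne_zero.2 hy.symm)
  rw [IsParetoEfficient, h, interior_closure_openSquare]

lemma not_isCompatible_openSquare : ¬ IsCompatible truncNorm openSquare := by
  intro h
  have hx₀ : (!₂[1, 0] : Plane) ∈ frontier openSquare := by
    rw [isOpen_openSquare.frontier_eq, closure_openSquare]
    constructor
    · intro i
      fin_cases i <;> simp
    · intro h
      simpa using h 0
  obtain ⟨Q, ⟨-, hsub⟩, p, hp, hQ⟩ := h _ hx₀
  obtain ⟨s, hs, rfl⟩ : ∃ s : ℝ, |s| = 1 ∧ p = !₂[s * Real.sqrt 2, 0] := by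
    rcases eq_of_mem_corners hp with h | h
    · exact ⟨1, by simp, by simpa using h⟩
    · exact ⟨-1, by simp, by simpa using h⟩
  have h2 : (0 : ℝ) < Real.sqrt 2 := by positivity
  have hs' := abs_le.1 hs.le
  -- The flat cone is `{|x₁| ≤ -s x₂}`; its point `(-1/2, -s/2)` leads from `(1, 0)` into the
  -- square.
  have hq : (!₂[-1 / 2, -s / 2] : Plane) ∈ flatCone truncNorm !₂[s * Real.sqrt 2, 0] := by
    refine ⟨_, _, (isFacetBasis_iff hs _ _).2 ⟨rfl, rfl⟩, (1 + s) / 4 * Real.sqrt 2,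
      (1 - s) / 4 * Real.sqrt 2, mul_nonneg (by linarith) h2.le, mul_nonneg (by linarith) h2.le,
      ?_⟩
    have hss : s ^ 2 = 1 := by rw [← sq_abs, hs, one_pow]
    ext i
    fin_cases i
    · simp
      field_simp
      linear_combination 4 * hss
    · simp
      field_simp
      ring
  have hU : (!₂[1, 0] + !₂[-1 / 2, -s / 2] : Plane) ∈ openSquare := by
    intro i
    fin_cases i
    · simp; norm_num
    · simp; constructor <;> linarith
  have := hsub ⟨⟨_, hQ hq, rfl⟩, subset_closure hU⟩
  rw [isOpen_openSquare.frontier_eq] at this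
  exact this.2 hU

/-! ### Non-existence of solutions -/

/-- The paraboloid `c - K (x₁ - a)² - x₂² / 2` and its gradient. -/
lemma hasGradientAt_paraboloid (c K a : ℝ) (x : Plane) :
    HasGradientAt (fun y : Plane => c - K * (y 0 - a) ^ 2 - y 1 ^ 2 / 2)
      !₂[-(2 * K * (x 0 - a)), -x 1] x := by
  rw [hasGradientAt_iff_hasFDerivAt]
  have h0 : HasFDerivAt (fun y : Plane => y 0) (EuclideanSpace.proj (𝕜 := ℝ) (0 : Fin 2)) x :=
    (EuclideanSpace.proj (𝕜 := ℝ) (0 : Fin 2)).hasFDerivAt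
  have h1 : HasFDerivAt (fun y : Plane => y 1) (EuclideanSpace.proj (𝕜 := ℝ) (1 : Fin 2)) x :=
    (EuclideanSpace.proj (𝕜 := ℝ) (1 : Fin 2)).hasFDerivAt
  have h := ((((h0.sub_const a).pow 2).const_mul K).const_sub c).sub
    ((h1.pow 2).mul_const (2⁻¹ : ℝ))
  simp only [← div_eq_mul_inv] at h
  refine h.congr_fderiv ?_
  ext y
  simp [inner_plane]
  ring

/-- Only the supersolution property is used. It fails near the side `x₁ = 1`: it forces slope at
least `√2` in the `x₂`-direction, but a continuous function vanishing on the boundary is nearly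
constant in `x₂` there. -/
lemma not_isViscositySolutionDirichlet {f : Plane → ℝ} (hf : ∀ x ∈ openSquare, f x = 1)
    (u : Plane → ℝ) :
    ¬ IsViscositySolutionDirichlet (hamiltonian truncNorm) f openSquare u := by
  rintro ⟨hcont, -, ⟨-, hsuper⟩, hbd⟩
  obtain ⟨δ, hδ, hunif⟩ := Metric.uniformContinuousOn_iff.1
    (isCompact_closure_openSquare.uniformContinuousOn_of_continuous hcont) (1 / 32) (by norm_num)
  obtain ⟨h, hh, hh1, hhδ⟩ : ∃ h : ℝ, 0 < h ∧ h ≤ 1 / 4 ∧ 3 * h < δ :=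
    ⟨min (1 / 4) (δ / 4), by positivity, min_le_left _ _, by
      linarith [min_le_right (1 / 4) (δ / 4)]⟩
  set a : ℝ := 1 - 2 * h with ha
  -- The box around `(a, 0)`, of half-widths `h` and `1 / 2`, on which `u` is touched from below.
  set B : Set Plane := {x | |x 0 - a| ≤ h ∧ |x 1| ≤ 1 / 2} with hB
  have hBU : B ⊆ openSquare := by
    rintro x ⟨h0, h1⟩ i
    have h0 := abs_le.1 h0
    have h1 := abs_le.1 h1
    fin_cases i
    · exact ⟨by simp; linarith, by simp; linarith⟩
    · exact ⟨by simp; linarith, by simp; linarith⟩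
  have hsmall : ∀ x ∈ B, |u x| < 1 / 32 := by
    intro x hx
    have hy : (!₂[1, x 1] : Plane) ∈ closure openSquare := by
      rw [closure_openSquare]
      have h1 := hBU hx 1
      intro i
      fin_cases i
      · simp
      · simpa using ⟨h1.1.le, h1.2.le⟩
    have hy' : (!₂[1, x 1] : Plane) ∈ frontier openSquare := by
      rw [isOpen_openSquare.frontier_eq]
      exact ⟨hy, fun h => by simpa using h 0⟩
    have hd : dist x !₂[1, x 1] < δ := by
      have h0 := abs_le.1 hx.1
      rw [EuclideanSpace.dist_eq, Fin.sum_univ_two]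
      simp [Real.sqrt_sq_eq_abs, Real.dist_eq]
      rw [abs_lt]
      constructor <;> linarith
    have := hunif x (subset_closure (hBU hx)) _ hy hd
    rwa [hbd _ hy', Real.dist_eq, sub_zero] at this
  have hBclosed : IsClosed B :=
    (isClosed_le (f := fun x : Plane => |x 0 - a|) (by fun_prop) continuous_const).inter
      (isClosed_le (f := fun x : Plane => |x 1|) (by fun_prop) continuous_const)
  have hBcompact : IsCompact B :=
    isCompact_closure_openSquare.of_isClosed_subset hBclosed (hBU.trans subset_closure)
  have hcenter : (!₂[a, 0] : Plane) ∈ B := by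
    simp [hB, hh.le]
  obtain ⟨m, hm, hmin⟩ := hBcompact.exists_isMinOn ⟨_, hcenter⟩
    (f := fun x => u x + (1 / h ^ 2) * (x 0 - a) ^ 2 + x 1 ^ 2 / 2)
    (((hcont.mono (hBU.trans subset_closure)).add (by fun_prop)).add (by fun_prop))
  have hmc := hmin hcenter
  simp at hmc
  have hum := abs_lt.1 (hsmall m hm)
  have huc := abs_lt.1 (hsmall _ hcenter)
  have hK : 0 ≤ (h ^ 2)⁻¹ * (m 0 - a) ^ 2 := by positivity
  -- The penalty is `1` for `x₁ = a ± h` and `1 / 8` for `x₂ = ± 1 / 2`, more than the oscillation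
  -- of `u`, so the minimum is attained in the interior of the box.
  have hm0 : |m 0 - a| < h := by
    refine lt_of_le_of_ne hm.1 fun he => ?_
    rw [← sq_abs (m 0 - a), he, inv_mul_cancel₀ (by positivity)] at hmc
    linarith [sq_nonneg (m 1)]
  have hm1 : |m 1| < 1 / 2 := by
    refine lt_of_le_of_ne hm.2 fun he => ?_
    rw [← sq_abs (m 1), he] at hmc
    linarith
  have hBm : B ∈ nhds m := by
    have hopen : IsOpen {x : Plane | |x 0 - a| < h ∧ |x 1| < 1 / 2} :=
      (isOpen_lt (f := fun x : Plane => |x 0 - a|) (by fun_prop) continuous_const).inter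
        (isOpen_lt (f := fun x : Plane => |x 1|) (by fun_prop) continuous_const)
    exact Filter.mem_of_superset (hopen.mem_nhds ⟨hm0, hm1⟩) fun x hx => ⟨hx.1.le, hx.2.le⟩
  obtain ⟨r, hr, hrB⟩ := Metric.nhds_basis_closedBall.mem_iff.1 hBm
  set c : ℝ := u m + (1 / h ^ 2) * (m 0 - a) ^ 2 + m 1 ^ 2 / 2 with hc
  have key := hsuper m (hBU hm) Set.univ
    (fun y : Plane => c - (1 / h ^ 2) * (y 0 - a) ^ 2 - y 1 ^ 2 / 2) isOpen_univ (Set.mem_univ m)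
    (ContDiff.contDiffOn (by fun_prop))
    ⟨r, hr, fun x hx => ⟨hBU (hrB hx), Set.mem_univ x⟩, fun x hx => by
      have : c ≤ u x + (1 / h ^ 2) * (x 0 - a) ^ 2 + x 1 ^ 2 / 2 := hmin (hrB hx)
      linarith⟩ (by simp only [hc]; ring)
  rw [hf m (hBU hm), (hasGradientAt_paraboloid c (1 / h ^ 2) a m).gradient] at key
  have hle := key.trans (hamiltonian_truncNorm_le _)
  have hsq : m 1 ^ 2 ≤ (1 / 2) ^ 2 := sq_le_sq.2 (hm.2.trans (le_abs_self _))
  rcases le_max_iff.1 hle with h1 | h1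
  · simp at h1
    have := sq_nonneg (2 * (h ^ 2)⁻¹ * (m 0 - a))
    linarith
  · linarith

end ParetoPeeling

theorem proposition4p9
    (U : Set ParetoPeeling.Plane)
    (hU : U = {x : ParetoPeeling.Plane | ∀ i : Fin 2, x i ∈ Set.Ioo (-1 : ℝ) 1})
    (φ : ParetoPeeling.Plane → ℝ)
    (hφ : ∀ x : ParetoPeeling.Plane, φ x = max (Real.sqrt 2 * |x 0|) ‖x‖)
    (f : ParetoPeeling.Plane → ℝ) (hf : ∀ x ∈ U, f x = 1) :
    ParetoPeeling.IsParetoEfficient φ U ∧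
      ¬ ParetoPeeling.IsCompatible φ U ∧
      ¬ ∃ u : ParetoPeeling.Plane → ℝ,
        ParetoPeeling.IsViscositySolutionDirichlet (ParetoPeeling.hamiltonian φ) f U u := by
  obtain rfl : φ = ParetoPeeling.truncNorm := funext hφ
  obtain rfl : U = ParetoPeeling.openSquare := hU
  exact ⟨ParetoPeeling.isParetoEfficient_openSquare, ParetoPeeling.not_isCompatible_openSquare,
    fun ⟨u, hu⟩ => ParetoPeeling.not_isViscositySolutionDirichlet hf u hu⟩
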